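/- A metric space $(X,d)$ is *geodesic* if any two points $x,y\in X$ are joined by a geodesic segment, i.e. the image of an isometric embedding $[0,d(x,y)]\to X$ sending the endpoints to $x$ and $y$; it is *$\delta$-hyperbolic* if it is geodesic and, in every geodesic triangle, each point of a side is within distance at most $\delta$ of some point of the union of the other two sides. Let $\mathrm{Isom}(X)$ be the group of isometries of $X$ onto itself. An isometry $f\in\mathrm{Isom}(X)$ is *hyperbolic* if for every $x\in X$ there is a $t>0$ such that $t\,|m-n|\le d(f^m x,f^n x)$ for all $m,n\in\mathbb{Z}$; it *has a periodic orbit* if $f^k x=x$ for some $x\in X$ and some integer $k\ge 1$. **Theorem.** Let $X_1,\dots,X_n$ be finitely many $\delta$-hyperbolic spaces, let $G$ be a group, and for each $i=1,\dots,n$ let $\rho_i\colon G\to\mathrm{Isom}(X_i)$ be a homomorphism such that 1. there is an element $f_i\in G$ such that $\rho_i(f_i)$ is hyperbolic; and 2. for each $g\in G$, either $\rho_i(g)$ has a periodic orbit or $\rho_i(g)$ is hyperbolic. Then there is an element $f\in G$ such that $\rho_i(f)$ is hyperbolic for all $i=1,\dots,n$. -/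

import Mathlib

namespace SimHyp

universe u

variable {X : Type u} [MetricSpace X]

/-- `σ` is (the image of) a geodesic segment from `x` to `y`. -/
def IsGeodesicSegment (x y : X) (σ : Set X) : Prop :=
  ∃ c : ℝ → X, c 0 = x ∧ c (dist x y) = y ∧
    (∀ s ∈ Set.Icc 0 (dist x y), ∀ t ∈ Set.Icc 0 (dist x y), dist (c s) (c t) = |s - t|) ∧
    c '' Set.Icc 0 (dist x y) = σ

variable (X) in
/-- Any two points are joined by a geodesic segment. -/
def IsGeodesicSpace : Prop :=
  ∀ x y : X, ∃ σ : Set X, IsGeodesicSegment x y σ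

variable (X) in
/-- A `δ`-hyperbolic space: a geodesic metric space all of whose geodesic triangles are `δ`-slim.
The vertices are arbitrary, so the condition on the side `α` covers every side of a triangle. -/
structure IsDeltaHyperbolic (δ : ℝ) : Prop where
  geodesic : IsGeodesicSpace X
  slim : ∀ (x y z : X) (α β γ : Set X),
    IsGeodesicSegment y z α → IsGeodesicSegment z x β → IsGeodesicSegment x y γ →
    ∀ p ∈ α, ∃ q ∈ β ∪ γ, dist p q ≤ δ

/-- Hyperbolic isometry: for every `x` the orbit map `n ↦ fⁿ x` expands distances by at least
some factor `t > 0`. -/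
def IsHyperbolicIsometry (f : X ≃ᵢ X) : Prop :=
  ∀ x : X, ∃ t : ℝ, 0 < t ∧
    ∀ m n : ℤ, t * |(m : ℝ) - (n : ℝ)| ≤ dist ((f ^ m) x) ((f ^ n) x)

/-- Some point of `X` is fixed by a positive power of `f`. -/
def HasPeriodicOrbit (f : X ≃ᵢ X) : Prop :=
  ∃ x : X, ∃ k : ℕ, 0 < k ∧ (f ^ k) x = x

end SimHyp

/-! Induct on the set of spaces. Let `f` be hyperbolic on the spaces treated so far and periodic on
a new one, where `g` is hyperbolic; a product `f ^ a * g ^ b` without periodic orbits on any of them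
suffices, by the dichotomy. The test is `FourPoint.not_hasPeriodicOrbit`: `w` moves `x` far compared
with the Gromov product of `w x` and `w⁻¹ x`. On an old space it holds for large `a` unless `g ^ b`
sends the attracting end of `f` to its repelling end, which is avoided when `b` is a multiple of a
suitable `p`. On the new space orbits of `f` are bounded, and for large `b` the exponent `a` or `2 *
a` works. So fix `b` first, then `a`. -/

namespace SimHyp

open Filter

/-! ### Gromov products and the four-point condition -/

section GromovProduct

variable {X : Type*} [MetricSpace X]

/-- The Gromov product of `x` and `y` based at `w`. -/
noncomputable def gromovProd (w x y : X) : ℝ := (dist w x + dist w y - dist x y) / 2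

theorem gromovProd_comm (w x y : X) : gromovProd w x y = gromovProd w y x := by
  unfold gromovProd
  rw [dist_comm x y]
  ring

theorem gromovProd_map (f : X ≃ᵢ X) (w x y : X) :
    gromovProd (f w) (f x) (f y) = gromovProd w x y := by
  simp [gromovProd, f.dist_eq]

theorem gromovProd_le_add_dist_right (w x y y' : X) :
    gromovProd w x y ≤ gromovProd w x y' + dist y y' := by
  unfold gromovProd
  linarith [dist_triangle w y' y, dist_triangle x y y', dist_comm y y']

theorem gromovProd_le_add_dist_left (w x x' y : X) :
    gromovProd w x y ≤ gromovProd w x' y + dist x x' := by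
  rw [gromovProd_comm w x, gromovProd_comm w x']
  exact gromovProd_le_add_dist_right w y x x'

theorem gromovProd_le_add_dist_base (w w' x y : X) :
    gromovProd w x y ≤ gromovProd w' x y + dist w w' := by
  unfold gromovProd
  linarith [dist_triangle w w' x, dist_triangle w w' y]

theorem gromovProd_map_le (f : X ≃ᵢ X) (w x y : X) :
    gromovProd w (f x) (f y) ≤ gromovProd w x y + dist w (f w) := by
  rw [← gromovProd_map f w x y]
  exact gromovProd_le_add_dist_base _ _ _ _

theorem le_gromovProd_map (f : X ≃ᵢ X) (w x y : X) :
    gromovProd w x y ≤ gromovProd w (f x) (f y) + dist w (f w) := by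
  rw [← gromovProd_map f w x y, dist_comm]
  exact gromovProd_le_add_dist_base _ _ _ _

theorem gromovProd_le_dist_of_between {x y q : X} (w : X)
    (h : dist x q + dist q y = dist x y) : gromovProd w x y ≤ dist w q := by
  unfold gromovProd
  linarith [dist_triangle w q x, dist_triangle w q y, dist_comm q x]

theorem IsGeodesicSegment.dist_add_dist {x y : X} {σ : Set X} (h : IsGeodesicSegment x y σ)
    {p : X} (hp : p ∈ σ) : dist x p + dist p y = dist x y := by
  obtain ⟨c, h0, h1, hc, rfl⟩ := h
  obtain ⟨t, ht, rfl⟩ := hp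
  have e0 := hc 0 ⟨le_rfl, dist_nonneg⟩ t ht
  have e1 := hc t ht (dist x y) ⟨dist_nonneg, le_rfl⟩
  rw [h0, zero_sub, abs_neg, abs_of_nonneg ht.1] at e0
  rw [h1, abs_sub_comm, abs_of_nonneg (sub_nonneg.2 ht.2)] at e1
  linarith

theorem IsGeodesicSegment.left_mem {x y : X} {σ : Set X} (h : IsGeodesicSegment x y σ) :
    x ∈ σ := by
  obtain ⟨c, h0, h1, hc, rfl⟩ := h
  exact ⟨0, ⟨le_rfl, dist_nonneg⟩, h0⟩

theorem IsGeodesicSegment.right_mem {x y : X} {σ : Set X} (h : IsGeodesicSegment x y σ) :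
    y ∈ σ := by
  obtain ⟨c, h0, h1, hc, rfl⟩ := h
  exact ⟨dist x y, ⟨dist_nonneg, le_rfl⟩, h1⟩

theorem IsGeodesicSegment.isPreconnected {x y : X} {σ : Set X} (h : IsGeodesicSegment x y σ) :
    IsPreconnected σ := by
  obtain ⟨c, h0, h1, hc, rfl⟩ := h
  refine isPreconnected_Icc.image c ?_
  refine LipschitzOnWith.continuousOn (K := 1) (LipschitzOnWith.of_dist_le_mul ?_)
  intro s hs t ht
  rw [hc s hs t ht, Real.dist_eq]
  simp

/-- In a slim triangle, some point of a side is close to both other sides. -/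
theorem IsDeltaHyperbolic.exists_near_both {δ : ℝ} (hX : IsDeltaHyperbolic X δ) {w x z : X}
    {α β γ : Set X} (hα : IsGeodesicSegment x z α) (hβ : IsGeodesicSegment z w β)
    (hγ : IsGeodesicSegment w x γ) :
    ∃ p ∈ α, ∃ q ∈ β, ∃ r ∈ γ, dist p q ≤ δ + 1 ∧ dist p r ≤ δ + 1 := by
  have hδ : 0 ≤ δ := by
    obtain ⟨q, -, hq⟩ := hX.slim w x z α β γ hα hβ hγ x hα.left_mem
    exact dist_nonneg.trans hq
  have hcl (s : Set X) : IsClosed {p | Metric.infDist p s ≤ δ} :=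
    isClosed_le (Metric.continuous_infDist_pt s) continuous_const
  have hcov : α ⊆ {p | Metric.infDist p β ≤ δ} ∪ {p | Metric.infDist p γ ≤ δ} := by
    intro p hp
    obtain ⟨q, hq | hq, hpq⟩ := hX.slim w x z α β γ hα hβ hγ p hp
    · exact Or.inl ((Metric.infDist_le_dist_of_mem hq).trans hpq)
    · exact Or.inr ((Metric.infDist_le_dist_of_mem hq).trans hpq)
  -- Two closed sets, each containing an endpoint, cover the connected side, so they meet on it.
  obtain ⟨p, hp, h1, h2⟩ := isPreconnected_closed_iff.1 hα.isPreconnected _ _ (hcl β) (hcl γ) hcov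
    ⟨z, hα.right_mem, by simpa [Metric.infDist_zero_of_mem hβ.left_mem] using hδ⟩
    ⟨x, hα.left_mem, by simpa [Metric.infDist_zero_of_mem hγ.right_mem] using hδ⟩
  obtain ⟨q, hq, hpq⟩ := (Metric.infDist_lt_iff ⟨z, hβ.left_mem⟩).1
    (lt_of_le_of_lt h1 (lt_add_one δ))
  obtain ⟨r, hr, hpr⟩ := (Metric.infDist_lt_iff ⟨w, hγ.left_mem⟩).1
    (lt_of_le_of_lt h2 (lt_add_one δ))
  exact ⟨p, hp, q, hq, r, hr, hpq.le, hpr.le⟩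

variable (X) in
/-- Gromov's four-point condition with constant `D`. -/
def FourPoint (D : ℝ) : Prop :=
  ∀ w x y z : X, min (gromovProd w x y) (gromovProd w y z) ≤ gromovProd w x z + D

/-- A point `p` of `[x, z]` near both `[z, w]` and `[w, x]` nearly realises the product of `x` and
`z`. It is also `δ`-close to `[z, y]` or `[y, x]`, whose distance from `w` bounds the corresponding
product. -/
theorem IsDeltaHyperbolic.fourPoint {δ : ℝ} (hX : IsDeltaHyperbolic X δ) :
    FourPoint X (3 * δ + 2) := by
  intro w x y z
  obtain ⟨α, hα⟩ := hX.geodesic x z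
  obtain ⟨β, hβ⟩ := hX.geodesic z w
  obtain ⟨γ, hγ⟩ := hX.geodesic w x
  obtain ⟨β', hβ'⟩ := hX.geodesic z y
  obtain ⟨γ', hγ'⟩ := hX.geodesic y x
  obtain ⟨p, hp, q, hq, r, hr, hpq, hpr⟩ := hX.exists_near_both hα hβ hγ
  have key : dist w p ≤ gromovProd w x z + 2 * (δ + 1) := by
    have e1 := hα.dist_add_dist hp
    have e2 := hβ.dist_add_dist hq
    have e3 := hγ.dist_add_dist hr
    unfold gromovProd
    linarith [dist_triangle w r p, dist_triangle x r p, dist_triangle w q p, dist_triangle z q p,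
      dist_comm p q, dist_comm p r, dist_comm x r, dist_comm z p, dist_comm w q, dist_comm w z,
      dist_comm z q]
  obtain ⟨s, hs | hs, hps⟩ := hX.slim y x z α β' γ' hα hβ' hγ' p hp
  · have h := gromovProd_le_dist_of_between w (hβ'.dist_add_dist hs)
    rw [gromovProd_comm] at h
    refine (min_le_right _ _).trans ?_
    linarith [dist_triangle w p s]
  · have h := gromovProd_le_dist_of_between w (hγ'.dist_add_dist hs)
    rw [gromovProd_comm] at h
    refine (min_le_left _ _).trans ?_
    linarith [dist_triangle w p s]

end GromovProduct

/-! ### Displacement growth and hyperbolic isometries -/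

section Isometry

variable {X : Type*} [MetricSpace X] {D : ℝ}

theorem dist_inv_apply (f : X ≃ᵢ X) (x y : X) : dist (f⁻¹ x) y = dist x (f y) := by
  rw [← f.dist_eq, ← IsometryEquiv.mul_apply, mul_inv_cancel]
  rfl

theorem dist_pow_add_apply (f : X ≃ᵢ X) (m k : ℕ) (x : X) :
    dist ((f ^ m) x) ((f ^ (m + k)) x) = dist x ((f ^ k) x) := by
  rw [pow_add, IsometryEquiv.mul_apply, IsometryEquiv.dist_eq]

theorem dist_inv_pow_apply (f : X ≃ᵢ X) (n : ℕ) (x : X) :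
    dist x ((f⁻¹ ^ n) x) = dist x ((f ^ n) x) := by
  rw [inv_pow, dist_comm, dist_inv_apply]

theorem dist_inv_pow_pow_apply (f : X ≃ᵢ X) (m n : ℕ) (x : X) :
    dist ((f ^ m) x) ((f⁻¹ ^ n) x) = dist x ((f ^ (m + n)) x) := by
  rw [inv_pow, dist_comm, dist_inv_apply, ← IsometryEquiv.mul_apply, ← pow_add, add_comm]

theorem HasPeriodicOrbit.bounded {f : X ≃ᵢ X} (h : HasPeriodicOrbit f) (y : X) :
    ∃ C, ∀ n : ℕ, dist y ((f ^ n) y) ≤ C := by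
  obtain ⟨x, k, hk, hx⟩ := h
  have hper (q : ℕ) : ((f ^ k) ^ q) x = x := by
    induction q with
    | zero => rfl
    | succ q ih => rw [pow_succ, IsometryEquiv.mul_apply, hx, ih]
  refine ⟨2 * dist y x + ∑ i ∈ Finset.range k, dist x ((f ^ i) x), fun n => ?_⟩
  have e : (f ^ n) x = (f ^ (n % k)) x := by
    conv_lhs => rw [← Nat.mod_add_div n k, pow_add, pow_mul, IsometryEquiv.mul_apply, hper]
  have h1 : dist x ((f ^ (n % k)) x) ≤ ∑ i ∈ Finset.range k, dist x ((f ^ i) x) :=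
    Finset.single_le_sum (f := fun i => dist x ((f ^ i) x)) (fun _ _ => dist_nonneg)
      (Finset.mem_range.2 (Nat.mod_lt n hk))
  have h2 := dist_triangle4 y x ((f ^ n) x) ((f ^ n) y)
  rw [IsometryEquiv.dist_eq, dist_comm x y, e] at h2
  linarith

/-- Displacements of iterates of `w` grow by a definite amount at each step as soon as they do so
from the first to the second step. -/
theorem FourPoint.dist_pow_succ (hX : FourPoint X D) (w : X ≃ᵢ X) (x : X) {ε : ℝ} (hε : 0 < ε)
    (h : dist x (w x) + 2 * D + ε ≤ dist x ((w ^ 2) x)) (hpos : ε ≤ dist x (w x)) (n : ℕ) :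
    dist x ((w ^ n) x) + ε ≤ dist x ((w ^ (n + 1)) x) := by
  induction n with
  | zero => simpa using hpos
  | succ n ih =>
    have h4 := hX (w x) x ((w ^ (n + 2)) x) ((w ^ 2) x)
    have e1 : dist (w x) ((w ^ (n + 2)) x) = dist x ((w ^ (n + 1)) x) := by
      simpa [add_comm, add_left_comm] using dist_pow_add_apply w 1 (n + 1) x
    have e2 : dist (w x) ((w ^ 2) x) = dist x (w x) := by
      simpa using dist_pow_add_apply w 1 1 x
    have e3 : dist ((w ^ (n + 2)) x) ((w ^ 2) x) = dist x ((w ^ n) x) := by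
      rw [dist_comm, add_comm n 2]
      exact dist_pow_add_apply w 2 n x
    simp only [gromovProd, e1, e2, e3, dist_comm (w x) x] at h4
    rcases min_le_iff.1 h4 with h5 | h5
    · rw [show n + 1 + 1 = n + 2 from rfl]
      linarith
    -- This alternative would make the displacement drop, against `ih`.
    · linarith

/-- Unfolding the product, `h` says that `w ^ 2` moves `x` at least `2 * D + 1` further than `w`;
displacements then grow linearly, while periodicity bounds them. -/
theorem FourPoint.not_hasPeriodicOrbit (hX : FourPoint X D) (w : X ≃ᵢ X) (x : X)
    (h : 2 * gromovProd x (w x) (w⁻¹ x) + 2 * D + 1 ≤ dist x (w x)) (h1 : 1 ≤ dist x (w x)) :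
    ¬ HasPeriodicOrbit w := by
  intro hp
  obtain ⟨C, hC⟩ := hp.bounded x
  have e1 := dist_inv_pow_apply w 1 x
  have e2 := dist_inv_pow_pow_apply w 1 1 x
  simp only [pow_one] at e1 e2
  have h2 : dist x (w x) + 2 * D + 1 ≤ dist x ((w ^ 2) x) := by
    simp only [gromovProd, e1, e2] at h
    norm_num at h
    linarith
  have hgrow (n : ℕ) : (n : ℝ) ≤ dist x ((w ^ n) x) := by
    induction n with
    | zero => simp
    | succ n ih =>
      push_cast
      linarith [hX.dist_pow_succ w x one_pos h2 h1 n]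
  obtain ⟨n, hn⟩ := exists_nat_gt C
  linarith [hgrow n, hC n]

theorem IsHyperbolicIsometry.inv {f : X ≃ᵢ X} (hf : IsHyperbolicIsometry f) :
    IsHyperbolicIsometry f⁻¹ := by
  intro x
  obtain ⟨t, ht, h⟩ := hf x
  refine ⟨t, ht, fun m n => ?_⟩
  have := h (-m) (-n)
  rw [zpow_neg, zpow_neg, ← inv_zpow, ← inv_zpow] at this
  convert this using 2
  rw [abs_sub_comm]
  push_cast
  congr 1
  ring

theorem IsHyperbolicIsometry.linear {f : X ≃ᵢ X} (hf : IsHyperbolicIsometry f) (x : X) :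
    ∃ t : ℝ, 0 < t ∧ ∀ n : ℕ, t * n ≤ dist x ((f ^ n) x) := by
  obtain ⟨t, ht, h⟩ := hf x
  refine ⟨t, ht, fun n => ?_⟩
  simpa using h 0 n

theorem IsHyperbolicIsometry.tendsto_dist {f : X ≃ᵢ X} (hf : IsHyperbolicIsometry f) (x : X) :
    Tendsto (fun n : ℕ => dist x ((f ^ n) x)) atTop atTop := by
  obtain ⟨t, ht, h⟩ := hf.linear x
  exact tendsto_atTop_mono h (tendsto_natCast_atTop_atTop.const_mul_atTop ht)

/-- Some iterate of a hyperbolic isometry satisfies the growth criterion. -/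
theorem IsHyperbolicIsometry.exists_pow_growth {f : X ≃ᵢ X} (hf : IsHyperbolicIsometry f) (x : X)
    (C : ℝ) : ∃ N : ℕ, 0 < N ∧ C ≤ dist x ((f ^ N) x) ∧
      dist x ((f ^ N) x) + C ≤ dist x ((f ^ (2 * N)) x) := by
  obtain ⟨t, ht, hlin⟩ := hf.linear x
  by_contra! hcon
  obtain ⟨M, hM⟩ := eventually_atTop.1 ((hf.tendsto_dist x).eventually_ge_atTop C)
  -- If growth always fails, each doubling of the exponent adds at most `|C|`: growth is
  -- logarithmic, against the linear lower bound.
  have hstep (k : ℕ) : dist x ((f ^ (2 ^ k * (M + 1))) x) ≤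
      dist x ((f ^ (M + 1)) x) + |C| * k := by
    induction k with
    | zero => simp
    | succ k ih =>
      have hge : M + 1 ≤ 2 ^ k * (M + 1) := Nat.le_mul_of_pos_left _ (by positivity)
      have := hcon (2 ^ k * (M + 1)) (by positivity) (hM _ (by omega))
      rw [pow_succ, mul_comm _ 2, mul_assoc]
      push_cast
      linarith [le_abs_self C]
  have hlim : Tendsto (fun k : ℕ => (k : ℝ) / 2 ^ k) atTop (nhds 0) := by
    simpa using tendsto_pow_const_div_const_pow_of_one_lt 1 (one_lt_two (α := ℝ))
  have hlim2 : Tendsto (fun k : ℕ => dist x ((f ^ (M + 1)) x) * ((1 : ℝ) / 2) ^ k +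
      |C| * ((k : ℝ) / 2 ^ k)) atTop (nhds 0) := by
    simpa using ((tendsto_pow_atTop_nhds_zero_of_lt_one (by norm_num : (0 : ℝ) ≤ 1 / 2)
      (by norm_num)).const_mul _).add (hlim.const_mul _)
  obtain ⟨k, hk⟩ := (hlim2.eventually_lt_const ht).exists
  have h1 := (hlin (2 ^ k * (M + 1))).trans (hstep k)
  have h2 : (0 : ℝ) < 2 ^ k := by positivity
  have h3 : (dist x ((f ^ (M + 1)) x) * ((1 : ℝ) / 2) ^ k + |C| * ((k : ℝ) / 2 ^ k)) * 2 ^ k =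
      dist x ((f ^ (M + 1)) x) + |C| * k := by
    rw [one_div, inv_pow]
    field_simp
  have h4 := mul_lt_mul_of_pos_right hk h2
  rw [h3] at h4
  push_cast at h1
  nlinarith [mul_nonneg (mul_pos ht h2).le (Nat.cast_nonneg (α := ℝ) M)]

/-- The two ends of a hyperbolic isometry are distinct. -/
theorem FourPoint.exists_gromovProd_pow_inv_le (hX : FourPoint X D) {f : X ≃ᵢ X}
    (hf : IsHyperbolicIsometry f) (x : X) :
    ∃ K, ∀ m n : ℕ, gromovProd x ((f ^ m) x) ((f⁻¹ ^ n) x) ≤ K := by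
  obtain ⟨N, hN, hN1, hN2⟩ := hf.exists_pow_growth x (|D| * 4 + 1)
  set w := f ^ N with hw
  have hD := le_abs_self D
  have hgrow := hX.dist_pow_succ w x (ε := 2 * |D| + 1) (by positivity)
    (by rw [hw, ← pow_mul, mul_comm N 2]; linarith) (by linarith [abs_nonneg D])
  have hpow (g : X ≃ᵢ X) (hg : ∀ n, dist x ((g ^ n) x) = dist x ((w ^ n) x)) (n : ℕ) :
      (dist x (w x) + 2 * |D| + 1) / 2 ≤ gromovProd x (g x) ((g ^ (n + 1)) x) := by
    have e := dist_pow_add_apply g 1 n x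
    have e1 := hg 1
    rw [pow_one, add_comm] at e
    rw [pow_one, pow_one] at e1
    rw [gromovProd, e, hg, hg, e1]
    linarith [hgrow n]
  have hbase : gromovProd x (w x) (w⁻¹ x) ≤ (dist x (w x) - 4 * |D| - 1) / 2 := by
    have e1 := dist_inv_pow_apply w 1 x
    have e2 := dist_inv_pow_pow_apply w 1 1 x
    simp only [pow_one] at e1 e2
    rw [gromovProd, e1, e2]
    rw [hw, ← pow_mul, mul_comm N, ← hw]
    norm_num
    linarith
  -- By `hpow`, powers stay close to `w x` or `w⁻¹ x` as seen from `x`; the gap to `hbase` survives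
  -- two uses of the four-point condition.
  have hmain (m n : ℕ) : gromovProd x ((w ^ (m + 1)) x) ((w⁻¹ ^ (n + 1)) x) ≤ dist x (w x) := by
    have h1 := hpow w (fun _ => rfl) m
    have h2 := hpow w⁻¹ (fun k => dist_inv_pow_apply w k x) n
    have h3 := hX x (w x) ((w ^ (m + 1)) x) (w⁻¹ x)
    have h4 := hX x ((w ^ (m + 1)) x) ((w⁻¹ ^ (n + 1)) x) (w⁻¹ x)
    rw [gromovProd_comm x _ (w⁻¹ x)] at h4
    have hd := abs_nonneg D
    have hd' : 0 ≤ dist x (w x) := dist_nonneg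
    rcases min_le_iff.1 h3 with h3 | h3
    · linarith
    rw [gromovProd_comm x (w⁻¹ x)] at h4
    rcases min_le_iff.1 h4 with h4 | h4
    · linarith
    · rw [gromovProd_comm x _ (w⁻¹ x)] at h4
      linarith
  set S := ∑ i ∈ Finset.range N, dist x ((f ^ i) x)
  have hmod (g : X ≃ᵢ X) (hg : ∀ i, dist x ((g ^ i) x) = dist x ((f ^ i) x)) (m : ℕ) :
      dist ((g ^ m) x) (((g ^ N) ^ (m / N + 1)) x) ≤ S + dist x (w x) := by
    have h1 : dist x ((g ^ (m % N)) x) ≤ S := by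
      rw [hg]
      exact Finset.single_le_sum (f := fun i => dist x ((f ^ i) x)) (fun _ _ => dist_nonneg)
        (Finset.mem_range.2 (Nat.mod_lt m hN))
    have e : (g ^ m) x = ((g ^ N) ^ (m / N)) ((g ^ (m % N)) x) := by
      rw [← IsometryEquiv.mul_apply, ← pow_mul, ← pow_add, Nat.div_add_mod]
    rw [e, pow_succ, IsometryEquiv.mul_apply, IsometryEquiv.dist_eq]
    have := dist_triangle ((g ^ (m % N)) x) x ((g ^ N) x)
    rw [hg N, dist_comm _ x] at this
    linarith
  refine ⟨dist x (w x) + 2 * (S + dist x (w x)), fun m n => ?_⟩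
  have h1 := hmod f (fun _ => rfl) m
  have h2 := hmod f⁻¹ (fun i => dist_inv_pow_apply f i x) n
  rw [inv_pow f N, ← hw] at h2
  have h3 := hmain (m / N) (n / N)
  have h4 := gromovProd_le_add_dist_left x ((f ^ m) x) ((w ^ (m / N + 1)) x) ((f⁻¹ ^ n) x)
  have h5 := gromovProd_le_add_dist_right x ((w ^ (m / N + 1)) x) ((f⁻¹ ^ n) x)
    ((w⁻¹ ^ (n / N + 1)) x)
  rw [← hw] at h1
  linarith

end Isometry

/-! ### Points at infinity and products of isometries -/

section Asymptotic

variable {X : Type*} [MetricSpace X] {D : ℝ}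

/-- Two sequences converge to the same point at infinity (the condition does not depend on the
base point `x`). -/
def Asymptotic (x : X) (u v : ℕ → X) : Prop :=
  ∀ K : ℝ, ∃ N, ∀ m ≥ N, ∀ n ≥ N, K ≤ gromovProd x (u m) (v n)

theorem Asymptotic.symm {x : X} {u v : ℕ → X} (h : Asymptotic x u v) : Asymptotic x v u := by
  intro K
  obtain ⟨N, hN⟩ := h K
  exact ⟨N, fun m hm n hn => by rw [gromovProd_comm]; exact hN n hn m hm⟩

theorem FourPoint.asymptotic_trans (hX : FourPoint X D) {x : X} {u v w : ℕ → X}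
    (h : Asymptotic x u v) (h' : Asymptotic x v w) : Asymptotic x u w := by
  intro K
  obtain ⟨N, hN⟩ := h (K + D)
  obtain ⟨M, hM⟩ := h' (K + D)
  refine ⟨max N M, fun m hm n hn => ?_⟩
  have h1 := hN m (le_of_max_le_left hm) (max N M) (le_max_left _ _)
  have h2 := hM (max N M) (le_max_right _ _) n (le_of_max_le_right hn)
  linarith [hX x (u m) (v (max N M)) (w n), le_min h1 h2]

theorem Asymptotic.map {x : X} {u v : ℕ → X} (h : Asymptotic x u v) (f : X ≃ᵢ X) :
    Asymptotic x (fun n => f (u n)) (fun n => f (v n)) := by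
  intro K
  obtain ⟨N, hN⟩ := h (K + dist x (f x))
  exact ⟨N, fun m hm n hn => by linarith [hN m hm n hn, le_gromovProd_map f x (u m) (v n)]⟩

theorem FourPoint.bounded_of_not_asymptotic (hX : FourPoint X D) {x : X} {u v : ℕ → X}
    (hu : Asymptotic x u u) (hv : Asymptotic x v v) (h : ¬ Asymptotic x u v) :
    ∃ K N, ∀ m ≥ N, ∀ n ≥ N, gromovProd x (u m) (v n) ≤ K := by
  unfold Asymptotic at h
  push Not at h
  obtain ⟨K, hK⟩ := h
  obtain ⟨N, hN⟩ := hu (K + 2 * |D|)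
  obtain ⟨M, hM⟩ := hv (K + 2 * |D|)
  refine ⟨K + 2 * |D|, max N M, fun m hm n hn => ?_⟩
  obtain ⟨m', hm', n', hn', hlt⟩ := hK (max N M)
  by_contra! hgt
  have h1 := hN m' (le_of_max_le_left hm') m (le_of_max_le_left hm)
  have h2 := hM n (le_of_max_le_right hn) n' (le_of_max_le_right hn')
  have h3 := hX x (u m') (u m) (v n)
  have h4 := hX x (u m') (v n) (v n')
  have hD := le_abs_self D
  have hD' := abs_nonneg D
  have h5 := le_min h1 hgt.le
  rcases min_le_iff.1 h4 with h4 | h4 <;> linarith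

/-- Bounded products between the forward and backward orbits make displacement additive up to `2 *
B`, so `x`, `f ^ m x`, `f ^ (m + k) x` are nearly aligned. -/
theorem FourPoint.asymptotic_orbit (hX : FourPoint X D) {f : X ≃ᵢ X}
    (hf : IsHyperbolicIsometry f) (x : X) :
    Asymptotic x (fun n => (f ^ n) x) (fun n => (f ^ n) x) := by
  obtain ⟨B, hB⟩ := hX.exists_gromovProd_pow_inv_le hf x
  have hadd (m k : ℕ) : dist x ((f ^ m) x) + dist x ((f ^ k) x) - 2 * B ≤
      dist x ((f ^ (m + k)) x) := by
    have := hB m k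
    rw [gromovProd, dist_inv_pow_apply, dist_inv_pow_pow_apply] at this
    linarith
  intro K
  obtain ⟨N, hN⟩ := eventually_atTop.1 ((hf.tendsto_dist x).eventually_ge_atTop (K + B))
  have key (m k : ℕ) (hm : N ≤ m) : K ≤ gromovProd x ((f ^ m) x) ((f ^ (m + k)) x) := by
    rw [gromovProd, dist_pow_add_apply]
    linarith [hadd m k, hN m hm]
  refine ⟨N, fun m hm n hn => ?_⟩
  rcases le_total m n with h | h
  · obtain ⟨k, rfl⟩ := Nat.exists_eq_add_of_le h
    exact key m k hm
  · obtain ⟨k, rfl⟩ := Nat.exists_eq_add_of_le h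
    rw [gromovProd_comm]
    exact key n k hn

theorem FourPoint.not_asymptotic_orbit_inv (hX : FourPoint X D) {f : X ≃ᵢ X}
    (hf : IsHyperbolicIsometry f) (x : X) :
    ¬ Asymptotic x (fun n => (f ^ n) x) (fun n => (f⁻¹ ^ n) x) := by
  intro h
  obtain ⟨K, hK⟩ := hX.exists_gromovProd_pow_inv_le hf x
  obtain ⟨N, hN⟩ := h (K + 1)
  linarith [hN N le_rfl N le_rfl, hK N N]

/-- If `h` does not send the attracting end of `f` to its repelling end, then `f ^ a * h` has no
periodic orbit for all large `a`. -/
theorem FourPoint.eventually_pow_mul (hX : FourPoint X D) {f h : X ≃ᵢ X}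
    (hf : IsHyperbolicIsometry f) (x : X)
    (hh : ¬ Asymptotic x (fun n => h ((f ^ n) x)) (fun n => (f⁻¹ ^ n) x)) :
    ∀ᶠ a : ℕ in atTop, ¬ HasPeriodicOrbit (f ^ a * h) := by
  obtain ⟨K, N, hK⟩ := hX.bounded_of_not_asymptotic ((hX.asymptotic_orbit hf x).map h)
    (hX.asymptotic_orbit hf.inv x) hh
  have hlarge := (hf.tendsto_dist x).eventually_ge_atTop
    (2 * (K + 2 * dist x (h x)) + 2 * |D| + 1 + dist x (h x) + |K| * 2)
  filter_upwards [hlarge, eventually_ge_atTop N] with a ha haN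
  have hprod : gromovProd x ((f ^ a * h) x) ((f ^ a * h)⁻¹ x) ≤ K + 2 * dist x (h x) := by
    rw [mul_inv_rev, IsometryEquiv.mul_apply, IsometryEquiv.mul_apply, ← inv_pow]
    have h1 := gromovProd_le_add_dist_left x ((f ^ a) (h x)) ((f ^ a) x) (h⁻¹ ((f⁻¹ ^ a) x))
    rw [IsometryEquiv.dist_eq, dist_comm (h x)] at h1
    have h2 := le_gromovProd_map h x ((f ^ a) x) (h⁻¹ ((f⁻¹ ^ a) x))
    rw [← IsometryEquiv.mul_apply h h⁻¹, mul_inv_cancel] at h2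
    have h3 := hK a haN a haN
    simp only [IsometryEquiv.coe_one, id] at h2
    linarith
  have hdist : dist x ((f ^ a) x) - dist x (h x) ≤ dist x ((f ^ a * h) x) := by
    rw [IsometryEquiv.mul_apply]
    have h1 := dist_triangle x ((f ^ a) (h x)) ((f ^ a) x)
    rw [IsometryEquiv.dist_eq, dist_comm (h x)] at h1
    linarith
  have hd : 0 ≤ dist x (h x) := dist_nonneg
  refine hX.not_hasPeriodicOrbit _ x ?_ ?_
  · linarith [le_abs_self D, abs_nonneg K]
  · linarith [abs_nonneg D, neg_abs_le K]

/-- Some power of `g` is such that none of its iterates sends the attracting end of `f` to its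
repelling end. -/
theorem FourPoint.exists_pow_not_asymptotic (hX : FourPoint X D) {f : X ≃ᵢ X} (g : X ≃ᵢ X)
    (hf : IsHyperbolicIsometry f) (x : X) :
    ∃ p : ℕ, 0 < p ∧ ∀ b, p ∣ b →
      ¬ Asymptotic x (fun n => (g ^ b) ((f ^ n) x)) (fun n => (f⁻¹ ^ n) x) := by
  have hne := hX.not_asymptotic_orbit_inv hf x
  set u : ℕ → X := fun n => (f ^ n) x with hu
  set v : ℕ → X := fun n => (f⁻¹ ^ n) x with hv
  by_cases hB : ∃ c k : ℕ, 0 < k ∧ Asymptotic x (fun n => (g ^ c) (u n)) v ∧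
      Asymptotic x (fun n => (g ^ (c + k)) (u n)) v
  · obtain ⟨c, k, hk, h1, h2⟩ := hB
    -- Two exponents with the same bad effect differ by `k`, so `g ^ k` fixes the attracting end.
    have hstab : Asymptotic x u (fun n => (g ^ k) (u n)) := by
      have := (hX.asymptotic_trans h1 h2.symm).map (g ^ c)⁻¹
      simpa only [pow_add, ← IsometryEquiv.mul_apply, inv_mul_cancel, inv_mul_cancel_left,
        IsometryEquiv.coe_one, id] using this
    have hstab' (q : ℕ) : Asymptotic x u (fun n => (g ^ (k * q)) (u n)) := by
      induction q with
      | zero => simpa using hX.asymptotic_orbit hf x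
      | succ q ih =>
        have := hX.asymptotic_trans hstab (ih.map (g ^ k))
        simpa only [← IsometryEquiv.mul_apply, ← pow_add, mul_add, mul_one, add_comm] using this
    refine ⟨k, hk, ?_⟩
    rintro _ ⟨q, rfl⟩ h
    exact hne (hX.asymptotic_trans (hstab' q) h)
  · push Not at hB
    by_cases hc : ∃ c, Asymptotic x (fun n => (g ^ c) (u n)) v
    · obtain ⟨c, hc⟩ := hc
      have hc0 : c ≠ 0 := by
        rintro rfl
        exact hne (by simpa using hc)
      -- Only `c` is bad, and it is no multiple of `2 * c`.
      refine ⟨2 * c, by omega, ?_⟩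
      rintro _ ⟨q, rfl⟩ h
      rcases Nat.eq_zero_or_pos q with rfl | hq
      · exact hne (by simpa using h)
      · have hle : c ≤ c * q := Nat.le_mul_of_pos_right c hq
        refine hB c (2 * c * q - c) ?_ hc ?_
        · rw [mul_assoc]
          omega
        · rwa [Nat.add_sub_cancel' (by rw [mul_assoc]; omega)]
    · push Not at hc
      exact ⟨1, one_pos, fun b _ => hc b⟩

/-- If `g` is hyperbolic and `f` has bounded orbits, then for all large `b` and all `a` one of
`f ^ a * g ^ b` and `f ^ (2 * a) * g ^ b` has no periodic orbit. -/
theorem FourPoint.eventually_mul_pow (hX : FourPoint X D) {f g : X ≃ᵢ X}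
    (hg : IsHyperbolicIsometry g) (x : X) {C : ℝ} (hC : ∀ n : ℕ, dist x ((f ^ n) x) ≤ C) :
    ∀ᶠ b : ℕ in atTop, ∀ a : ℕ, ¬ HasPeriodicOrbit (f ^ a * g ^ b) ∨
      ¬ HasPeriodicOrbit (f ^ (2 * a) * g ^ b) := by
  obtain ⟨K, hK⟩ := hX.exists_gromovProd_pow_inv_le hg x
  have hC0 : 0 ≤ C := dist_nonneg.trans (hC 0)
  -- The final comparison uses the four-point condition twice and translates by `f ^ a` twice.
  set L := |K| + 2 * C + 2 * |D| with hL
  have hL0 : 0 ≤ L := by positivity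
  have hcrit (b a : ℕ) (hb : 2 * (L + C) + 2 * |D| + 1 + C ≤ dist x ((g ^ b) x))
      (h : gromovProd x ((f ^ a) ((g ^ b) x)) ((g⁻¹ ^ b) x) ≤ L) :
      ¬ HasPeriodicOrbit (f ^ a * g ^ b) := by
    have hprod : gromovProd x ((f ^ a * g ^ b) x) ((f ^ a * g ^ b)⁻¹ x) ≤ L + C := by
      rw [mul_inv_rev, IsometryEquiv.mul_apply, IsometryEquiv.mul_apply, ← inv_pow, ← inv_pow]
      have h1 := gromovProd_le_add_dist_right x ((f ^ a) ((g ^ b) x))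
        ((g⁻¹ ^ b) ((f⁻¹ ^ a) x)) ((g⁻¹ ^ b) x)
      rw [IsometryEquiv.dist_eq, dist_comm, dist_inv_pow_apply] at h1
      linarith [hC a]
    have hdist : dist x ((g ^ b) x) - C ≤ dist x ((f ^ a * g ^ b) x) := by
      rw [IsometryEquiv.mul_apply]
      have h1 := dist_triangle ((f ^ a) x) x ((f ^ a) ((g ^ b) x))
      rw [IsometryEquiv.dist_eq, dist_comm _ x] at h1
      linarith [hC a]
    refine hX.not_hasPeriodicOrbit _ x ?_ ?_
    · linarith [le_abs_self D]
    · linarith [abs_nonneg D]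
  filter_upwards [(hg.tendsto_dist x).eventually_ge_atTop (2 * (L + C) + 2 * |D| + 1 + C)]
    with b hb a
  by_contra! hcon
  have h1 : L < gromovProd x ((f ^ a) ((g ^ b) x)) ((g⁻¹ ^ b) x) := by
    by_contra! h
    exact hcrit b a hb h hcon.1
  have h2 : L < gromovProd x ((f ^ (2 * a)) ((g ^ b) x)) ((g⁻¹ ^ b) x) := by
    by_contra! h
    exact hcrit b (2 * a) hb h hcon.2
  -- Translating `h1` by `f ^ a` and comparing with `h2` puts `f ^ a` of `g⁻¹ ^ b x` near `g⁻¹ ^ b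
  -- x`, hence near `f ^ a` of `g ^ b x`. Undoing `f ^ a` contradicts `hK`.
  have h3 := le_gromovProd_map (f ^ a) x ((f ^ a) ((g ^ b) x)) ((g⁻¹ ^ b) x)
  rw [← IsometryEquiv.mul_apply (f ^ a) (f ^ a), ← pow_add, ← two_mul] at h3
  have h4 := hX x ((f ^ a) ((g⁻¹ ^ b) x)) ((f ^ (2 * a)) ((g ^ b) x)) ((g⁻¹ ^ b) x)
  have h5 := hX x ((f ^ a) ((g ^ b) x)) ((g⁻¹ ^ b) x) ((f ^ a) ((g⁻¹ ^ b) x))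
  have h6 := gromovProd_map_le (f ^ a) x ((g ^ b) x) ((g⁻¹ ^ b) x)
  rw [gromovProd_comm x ((f ^ a) ((g⁻¹ ^ b) x)) ((f ^ (2 * a)) ((g ^ b) x)),
    gromovProd_comm x ((f ^ a) ((g⁻¹ ^ b) x)) ((g⁻¹ ^ b) x)] at h4
  have hD := le_abs_self D
  have hD' := abs_nonneg D
  have hK' := hK b b
  have hKa := le_abs_self K
  have hCa := hC a
  rcases min_le_iff.1 h4 with h4 | h4 <;> rcases min_le_iff.1 h5 with h5 | h5 <;> linarith

end Asymptotic

end SimHyp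

/-! ### Induction over the spaces -/

open SimHyp in
theorem theorem5p1 {n : ℕ} {δ : ℝ} (X : Fin n → Type*) [∀ i, MetricSpace (X i)]
    (hX : ∀ i, SimHyp.IsDeltaHyperbolic (X i) δ)
    (G : Type*) [Group G] (ρ : ∀ i, G →* (X i ≃ᵢ X i))
    (hhyp : ∀ i, ∃ g : G, SimHyp.IsHyperbolicIsometry (ρ i g))
    (hdich : ∀ i, ∀ g : G,
      SimHyp.HasPeriodicOrbit (ρ i g) ∨ SimHyp.IsHyperbolicIsometry (ρ i g)) :
    ∃ f : G, ∀ i, SimHyp.IsHyperbolicIsometry (ρ i f) := by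
  classical
  suffices h : ∀ s : Finset (Fin n), ∃ f : G, ∀ i ∈ s, IsHyperbolicIsometry (ρ i f) by
    obtain ⟨f, hf⟩ := h Finset.univ
    exact ⟨f, fun i => hf i (Finset.mem_univ i)⟩
  intro s
  induction s using Finset.induction_on with
  | empty => exact ⟨1, by simp⟩
  | insert j s _ ih =>
    obtain ⟨f, hf⟩ := ih
    obtain hfj | hfj := (hdich j f).symm
    · exact ⟨f, Finset.forall_mem_insert _ _ _ |>.2 ⟨hfj, hf⟩⟩
    obtain ⟨g, hg⟩ := hhyp j
    have hpow : ∀ i ∈ s, ∃ p : ℕ, 0 < p ∧ ∀ b, p ∣ b →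
        ∀ᶠ a : ℕ in Filter.atTop, ¬ HasPeriodicOrbit (ρ i f ^ a * ρ i g ^ b) := by
      intro i hi
      rcases isEmpty_or_nonempty (X i) with hem | ⟨⟨x⟩⟩
      · exact ⟨1, one_pos, fun b _ => .of_forall fun a ⟨x, _⟩ => hem.elim x⟩
      · obtain ⟨p, hp, h⟩ := (hX i).fourPoint.exists_pow_not_asymptotic (ρ i g) (hf i hi) x
        exact ⟨p, hp, fun b hb => (hX i).fourPoint.eventually_pow_mul (hf i hi) x (h b hb)⟩
    choose! p hp hpb using hpow
    have ⟨x, _⟩ := hfj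
    obtain ⟨C, hC⟩ := hfj.bounded x
    obtain ⟨B, hB⟩ := Filter.eventually_atTop.1 ((hX j).fourPoint.eventually_mul_pow hg x hC)
    set b := (∏ i ∈ s, p i) * B
    have hev : ∀ᶠ a : ℕ in Filter.atTop, ∀ i ∈ s,
        ¬ HasPeriodicOrbit (ρ i f ^ a * ρ i g ^ b) :=
      s.eventually_all.2 fun i hi =>
        hpb i hi b ((Finset.dvd_prod_of_mem p hi).trans (dvd_mul_right _ _))
    obtain ⟨A, hA⟩ := Filter.eventually_atTop.1 hev
    -- Both candidates `A` and `2 * A` are large enough for the old spaces.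
    obtain ⟨a, ha, haj⟩ : ∃ a ≥ A, ¬ HasPeriodicOrbit (ρ j f ^ a * ρ j g ^ b) := by
      rcases hB b (Nat.le_mul_of_pos_left B (Finset.prod_pos hp)) A with h | h
      · exact ⟨A, le_rfl, h⟩
      · exact ⟨2 * A, by omega, h⟩
    refine ⟨f ^ a * g ^ b, fun i hi => (hdich i _).resolve_left ?_⟩
    rw [map_mul, map_pow, map_pow]
    rcases Finset.mem_insert.1 hi with rfl | hi
    · exact haj
    · exact hA a ha i hi
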